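/- **Theorem (Fouché).** A *tree* is a finite, non-empty partial order in which every two elements have a common predecessor and the set of predecessors of each element is linearly ordered (every node counts as its own predecessor). For nodes $v,w$ of a tree $T$, let $v\wedge_T w$ be the largest common predecessor of $v$ and $w$; let $\mathrm{im}_T(v)$ be the set of immediate successors of $v$ (not including $v$); let $\mathrm{ht}_T(v)$ be the number of predecessors of $v$ (including $v$), and $\mathrm{ht}(T)=\max_{v\in T}\mathrm{ht}_T(v)$. An *ordered tree* is a tree $T$ together with a linear order on $\mathrm{im}_T(v)$ for each $v\in T$; it induces the lexicographic linear order $\leq_T$ on $T$, where $v\leq_T w$ if and only if either $v$ is a predecessor of $w$, or neither of $v,w$ is a predecessor of the other and the predecessor of $v$ in $\mathrm{im}_T(v\wedge_T w)$ is less than or equal to the predecessor of $w$ in $\mathrm{im}_T(v\wedge_T w)$ in the given order of $\mathrm{im}_T(v\wedge_T w)$. A *height preserving embedding* from an ordered tree $S$ to an ordered tree $T$ is an injective function $f\colon S\to T$ such that $v\leq_S w$ implies $f(v)\leq_T f(w)$, $f(v\wedge_S w)=f(v)\wedge_T f(w)$, and $\mathrm{ht}_S(v)=\mathrm{ht}_T(f(v))$,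 for all $v,w\in S$. For $r\in\mathbb N=\{0,1,2,\dots\}$, an *$r$-coloring* of a set $X$ is a function on $X$ with at most $r$ values. Let $r\in\mathbb N$ and let $S$ and $T$ be ordered trees. Then there is an ordered tree $V$ such that $\mathrm{ht}(V)=\mathrm{ht}(T)$ and, for each $r$-coloring $\chi$ of the set of all height preserving embeddings from $S$ to $V$, there is a height preserving embedding $g\colon T\to V$ such that $\chi$ is constant on the set $$\{g\circ f\colon f \text{ a height preserving embedding of } S \text{ to } T\}.$$ -/

import Mathlib

universe u w

/-- An ordered tree: a finite non-empty partial order in which any two elements have a common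
predecessor and the predecessors of each element are linearly ordered, together with a linear
order on the set of immediate successors of each node. `a ≤ b` reads "`a` is a predecessor of `b`";
`v ⋖ c` reads "`c` is an immediate successor of `v`". -/
structure OrderedTree where
  Node : Type u
  [partialOrder : PartialOrder Node]
  [finite : Finite Node]
  [nonempty : Nonempty Node]
  common_pred : ∀ v w : Node, ∃ x, x ≤ v ∧ x ≤ w
  linear_pred : ∀ v x y : Node, x ≤ v → y ≤ v → x ≤ y ∨ y ≤ x
  imOrder : ∀ v : Node, LinearOrder {c : Node // v ⋖ c}

namespace OrderedTree

attribute [instance] OrderedTree.partialOrder OrderedTree.finite OrderedTree.nonempty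

variable (T : OrderedTree.{u})

theorem exists_meet (v w : T.Node) : ∃ m, IsGreatest {x : T.Node | x ≤ v ∧ x ≤ w} m := by
  obtain ⟨m, hm⟩ := (Set.toFinite {x : T.Node | x ≤ v ∧ x ≤ w}).exists_maximal (T.common_pred v w)
  refine ⟨m, hm.prop, fun x hx => ?_⟩
  rcases T.linear_pred v x m hx.1 hm.prop.1 with h | h
  · exact h
  · exact hm.le_of_ge hx h

/-- The largest common predecessor of `v` and `w`. -/
noncomputable def meet (v w : T.Node) : T.Node := (T.exists_meet v w).choose

theorem meet_spec (v w : T.Node) : IsGreatest {x : T.Node | x ≤ v ∧ x ≤ w} (T.meet v w) :=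
  (T.exists_meet v w).choose_spec

/-- The height of a node: the number of its predecessors, itself included. -/
noncomputable def htAt (v : T.Node) : ℕ := {x : T.Node | x ≤ v}.ncard

/-- The height of the tree: the maximum of the heights of its nodes (see `isGreatest_ht`). -/
noncomputable def ht : ℕ := ⨆ v : T.Node, T.htAt v

theorem isGreatest_ht : IsGreatest (Set.range T.htAt) T.ht :=
  ⟨Nat.sSup_mem (Set.range_nonempty _) (Set.finite_range _).bddAbove,
    fun _ h => le_csSup (Set.finite_range _).bddAbove h⟩

/-- The lexicographic linear order on all nodes: `v` is a predecessor of `w`, or `v` and `w` are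
incomparable and the predecessor of `v` among the immediate successors of `v ∧ w` is less than or
equal to the predecessor of `w` there. -/
def lexLE (v w : T.Node) : Prop :=
  v ≤ w ∨ (¬ v ≤ w ∧ ¬ w ≤ v ∧ ∃ a b : {c : T.Node // T.meet v w ⋖ c},
    a.1 ≤ v ∧ b.1 ≤ w ∧ (T.imOrder (T.meet v w)).le a b)

end OrderedTree

/-- Height preserving embeddings from `S` to `T`. -/
@[ext]
structure HeightEmb (S T : OrderedTree.{u}) where
  toFun : S.Node → T.Node
  injective : Function.Injective toFun
  map_lexLE : ∀ v w, S.lexLE v w → T.lexLE (toFun v) (toFun w)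
  map_meet : ∀ v w, toFun (S.meet v w) = T.meet (toFun v) (toFun w)
  map_htAt : ∀ v, S.htAt v = T.htAt (toFun v)

/-- The composition `g ∘ f`. -/
def HeightEmb.comp {S T V : OrderedTree.{u}} (g : HeightEmb T V) (f : HeightEmb S T) :
    HeightEmb S V where
  toFun := g.toFun ∘ f.toFun
  injective := g.injective.comp f.injective
  map_lexLE v w h := g.map_lexLE _ _ (f.map_lexLE v w h)
  map_meet v w := by simp only [Function.comp_apply, f.map_meet, g.map_meet]
  map_htAt v := (f.map_htAt v).trans (g.map_htAt _)

/-! An ordered tree of height `h + 1` embeds into some `uniform h n`, so it is enough to color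
embeddings of `S` into `uniform h N` and to find a good copy of `uniform h n` there. Such an
embedding is determined by its labels: an increasing placement of the children of the root among the
branches and, independently, a labeling above each child. This recursion is `BranchSet.cone`;
embeddings between uniform trees are given by `BranchMap`s acting on labelings.

The Ramsey property of labelings follows by induction on the height, and `isRamsey_cone` is the
inductive step. Let `α` be the set of children. Ramsey's theorem gives `P` such that colorings of `α
↪o Fin P` become constant on some `n` of the `P` branches. Above each of the `P` branches the
subtree is thinned by a product Ramsey argument (`exists_ramsey_pi_embedding`) until, for each
placement, the color no longer depends on the data above the children. It then depends on the
placement alone, and Ramsey's theorem selects the `n` branches. -/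

/-! ### The finite Ramsey theorem -/

/-- The inductive step of Ramsey's theorem before the pigeonhole: the color of a set is made to
depend on its minimum only. The minimum of `X` is split off, the rest is thinned so that sets with
this minimum share a color, and the argument is repeated inside what remains. -/
theorem Finset.exists_subset_card_eq_forall_insert_eq {K : Type*} {k : ℕ}
    (hk : ∀ n : ℕ, ∃ N : ℕ, ∀ X : Finset ℕ, N ≤ X.card → ∀ χ : Finset ℕ → K,
      ∃ Y ⊆ X, Y.card = n ∧ ∃ c, ∀ A ⊆ Y, A.card = k → χ A = c) (m : ℕ) :
    ∃ N : ℕ, ∀ X : Finset ℕ, N ≤ X.card → ∀ χ : Finset ℕ → K,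
      ∃ Y ⊆ X, Y.card = m ∧ ∃ d : ℕ → K, ∀ a ∈ Y, ∀ B ⊆ Y, B.card = k → (∀ b ∈ B, a < b) →
        χ (insert a B) = d a := by
  induction m with
  | zero =>
    refine ⟨0, fun X _ χ => ⟨∅, by simp, rfl, fun _ => χ ∅, by simp⟩⟩
  | succ m ih =>
    obtain ⟨M, hM⟩ := ih
    obtain ⟨N, hN⟩ := hk M
    refine ⟨N + 1, fun X hX χ => ?_⟩
    have hne : X.Nonempty := Finset.card_pos.1 (by omega)
    set x := X.min' hne with hx
    have hxX : x ∈ X := X.min'_mem hne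
    obtain ⟨Y', hY'X, hY'c, c, hc⟩ := hN (X.erase x) (by rw [Finset.card_erase_of_mem hxX]; omega)
      (fun B => χ (insert x B))
    obtain ⟨Y, hYY', hYc, d, hd⟩ := hM Y' hY'c.ge χ
    have hlt : ∀ y ∈ Y, x < y := fun y hy => X.min'_lt_of_mem_erase_min' hne (hY'X (hYY' hy))
    have hxY : x ∉ Y := fun h => lt_irrefl _ (hlt x h)
    refine ⟨insert x Y, ?_, by rw [Finset.card_insert_of_notMem hxY, hYc],
      Function.update d x c, ?_⟩
    · intro y hy
      rcases Finset.mem_insert.1 hy with rfl | hy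
      · exact hxX
      · exact Finset.mem_of_mem_erase (hY'X (hYY' hy))
    · intro a ha B hB hBk hab
      have hxB : x ∉ B := by
        intro h
        rcases Finset.mem_insert.1 ha with rfl | ha
        · exact lt_irrefl _ (hab _ h)
        · exact lt_asymm (hlt a ha) (hab x h)
      have hBY : B ⊆ Y := (Finset.subset_insert_iff_of_notMem hxB).1 hB
      rcases Finset.mem_insert.1 ha with rfl | ha
      · rw [Function.update_self]
        exact hc B (hBY.trans hYY') hBk
      · rw [Function.update_of_ne (hlt a ha).ne']
        exact hd a ha B hBY hBk hab

/-- The finite Ramsey theorem for colorings of the `k`-element subsets of a set of numbers. -/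
theorem Finset.exists_homogeneous_subset {K : Type*} [Finite K] (k n : ℕ) :
    ∃ N : ℕ, ∀ X : Finset ℕ, N ≤ X.card → ∀ χ : Finset ℕ → K,
      ∃ Y ⊆ X, Y.card = n ∧ ∃ c, ∀ A ⊆ Y, A.card = k → χ A = c := by
  classical
  induction k generalizing n with
  | zero =>
    refine ⟨n, fun X hX χ => ?_⟩
    obtain ⟨Y, hY, hYc⟩ := Finset.exists_subset_card_eq hX
    refine ⟨Y, hY, hYc, χ ∅, fun A _ hA => by rw [Finset.card_eq_zero.1 hA]⟩
  | succ k ih =>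
    cases nonempty_fintype K
    -- With more than `card K * n` candidates for the minimum, more than `n` of them share a color.
    obtain ⟨N, hN⟩ := Finset.exists_subset_card_eq_forall_insert_eq ih (Fintype.card K * n + 1)
    refine ⟨N, fun X hX χ => ?_⟩
    obtain ⟨Y, hYX, hYc, d, hd⟩ := hN X hX χ
    obtain ⟨c, -, hc⟩ := Finset.exists_lt_card_fiber_of_mul_lt_card_of_maps_to
      (s := Y) (t := Finset.univ) (f := d) (n := n) (fun _ _ => Finset.mem_univ _)
      (by rw [hYc, Finset.card_univ]; omega)
    obtain ⟨Z, hZ, hZc⟩ := Finset.exists_subset_card_eq hc.le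
    refine ⟨Z, (hZ.trans (Finset.filter_subset _ _)).trans hYX, hZc, c, fun A hA hAk => ?_⟩
    have hne : A.Nonempty := Finset.card_pos.1 (by omega)
    have hmem := A.min'_mem hne
    have ha := Finset.mem_filter.1 (hZ (hA hmem))
    rw [← Finset.insert_erase hmem, ← ha.2]
    refine hd _ ha.1 _ ?_ ?_ ?_
    · exact (Finset.erase_subset _ _).trans (hA.trans (hZ.trans (Finset.filter_subset _ _)))
    · rw [Finset.card_erase_of_mem hmem]; omega
    · exact fun b hb => A.min'_lt_of_mem_erase_min' hne hb

/-- The finite Ramsey theorem for colorings of the increasing maps from a finite linear order. -/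
theorem OrderEmbedding.exists_ramsey (α : Type*) [LinearOrder α] [Finite α] (K : Type*) [Finite K]
    (n : ℕ) : ∃ N, n ≤ N ∧ ∀ χ : (α ↪o Fin N) → K, ∃ i : Fin n ↪o Fin N,
      ∀ j j' : α ↪o Fin n, χ (j.trans i) = χ (j'.trans i) := by
  classical
  cases nonempty_fintype α
  obtain ⟨N, hN⟩ := Finset.exists_homogeneous_subset (K := K) (Fintype.card α) n
  refine ⟨max n N, le_max_left _ _, fun χ => ?_⟩
  rcases isEmpty_or_nonempty K with hK | ⟨⟨k₀⟩⟩
  · exact ⟨Fin.castLEOrderEmb (le_max_left _ _),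
      fun j => hK.elim (χ (j.trans (Fin.castLEOrderEmb _)))⟩
  -- An increasing map is determined by its range, so `χ` transfers to sets of numbers; sets that
  -- are not such ranges get the default `k₀`.
  let F : (α ↪o Fin (max n N)) → Finset ℕ := fun j => Finset.univ.image (fun a => (j a : ℕ))
  have hF : Function.Injective F := by
    intro j j' h
    have hr : ∀ j, (F j : Set ℕ) = Fin.val '' Set.range j := fun j => by
      ext; simp [F]
    refine OrderEmbedding.range_inj.1 (Fin.val_injective.image_injective ?_)
    rw [← hr, ← hr, h]
  obtain ⟨Y, hYX, hYc, c, hc⟩ := hN (Finset.range (max n N)) (by simp)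
    (Function.extend F χ fun _ => k₀)
  let i : Fin n ↪o Fin (max n N) := OrderEmbedding.ofStrictMono
    (fun a => ⟨Y.orderEmbOfFin hYc a, Finset.mem_range.1 (hYX (Y.orderEmbOfFin_mem hYc a))⟩)
    (fun a b h => (Y.orderEmbOfFin hYc).strictMono h)
  have key : ∀ j : α ↪o Fin n, χ (j.trans i) = c := by
    intro j
    rw [← hF.extend_apply χ (fun _ => k₀)]
    apply hc
    · intro y hy
      obtain ⟨a, -, rfl⟩ := Finset.mem_image.1 hy
      exact Y.orderEmbOfFin_mem hYc _
    · exact Finset.card_image_of_injective _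
        (Fin.val_injective.comp (j.trans i).injective)
  exact ⟨i, fun j j' => (key j).trans (key j').symm⟩

/-! ### Branch maps -/

/-- A choice, for every node of the infinite `n`-branching tree, of an increasing map from its
children to the children of a node of the infinite `N`-branching tree. -/
def BranchMap (n N : ℕ) := List (Fin n) → (Fin n ↪o Fin N)

namespace BranchMap

variable {n m N : ℕ}

/-- The restriction to the subtree above a child of the root. -/
def sub (g : BranchMap n N) (a : Fin n) : BranchMap n N := fun l => g (a :: l)

/-- The map on nodes induced by a branch map. -/
def map : BranchMap n N → List (Fin n) → List (Fin N)
  | _, [] => []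
  | g, a :: l => g [] a :: map (g.sub a) l

/-- `g` must be read at the image of the node under `f`. -/
def comp (g : BranchMap m N) (f : BranchMap n m) : BranchMap n N :=
  fun l => (f l).trans (g (f.map l))

def incl (h : n ≤ N) : BranchMap n N := fun _ => Fin.castLEOrderEmb h

/-- The branch map with given values at the root and above the children of the root. -/
def join (i : Fin n ↪o Fin N) (g : Fin n → BranchMap n N) : BranchMap n N
  | [] => i
  | a :: l => g a l

end BranchMap

/-! ### The Ramsey property of sets with an action of branch maps -/

/-- A family of finite sets on which branch maps act. -/
structure BranchSet where
  obj : ℕ → Type u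
  finite : ∀ n, Finite (obj n)
  act : ∀ {n N}, BranchMap n N → obj n → obj N
  act_comp : ∀ {n m N} (g : BranchMap m N) (f : BranchMap n m) (x : obj n),
    act (g.comp f) x = act g (act f x)

namespace BranchSet

attribute [instance] BranchSet.finite

def point : BranchSet.{u} where
  obj _ := PUnit
  finite _ := inferInstance
  act _ x := x
  act_comp _ _ _ := rfl

/-- Increasing placements of a set of children below the root, with a datum above each child. -/
def cone {α : Type u} [LinearOrder α] [Finite α] (X : α → BranchSet.{u}) : BranchSet.{u} where
  obj N := (α ↪o Fin N) × (∀ c, (X c).obj N)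
  finite N := by
    have : Finite (α ↪o Fin N) := DFunLike.finite _
    infer_instance
  act g x := (x.1.trans (g []), fun c => (X c).act (g.sub (x.1 c)) (x.2 c))
  act_comp g f x := by
    refine Prod.ext rfl (funext fun c => ?_)
    exact (X c).act_comp (g.sub (f [] (x.1 c))) (f.sub (x.1 c)) (x.2 c)

/-- The bound `n ≤ N` provides `BranchMap.incl`, used wherever some branch map is needed but the
choice is immaterial. -/
def IsRamsey (X : BranchSet.{u}) : Prop :=
  ∀ (n : ℕ) (K : Type u) [Finite K], ∃ N, n ≤ N ∧ ∀ χ : X.obj N → K, ∃ g : BranchMap n N,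
    ∀ x y, χ (X.act g x) = χ (X.act g y)

theorem isRamsey_point : point.{u}.IsRamsey :=
  fun n _ _ => ⟨n, le_rfl, fun _ => ⟨BranchMap.incl le_rfl, fun _ _ => rfl⟩⟩

variable {α : Type u} {X : α → BranchSet.{u}}

/-- Coordinates in `s` are made irrelevant one at a time. For a new coordinate `a`, an element of
`(X a).obj M` is colored by the whole function that sends the other coordinates to the resulting
color, so a single `g` works for all their values. -/
theorem exists_ramsey_pi_finset [Finite α] (hX : ∀ c, (X c).IsRamsey) (K : Type u) [Finite K]
    (n : ℕ) (s : Finset α) :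
    ∃ N, n ≤ N ∧ ∀ χ : (∀ c, (X c).obj N) → K, ∃ g : α → BranchMap n N,
      ∀ x y : ∀ c, (X c).obj n, (∀ c ∉ s, x c = y c) →
        χ (fun c => (X c).act (g c) (x c)) = χ (fun c => (X c).act (g c) (y c)) := by
  classical
  induction s using Finset.induction_on with
  | empty =>
    exact ⟨n, le_rfl, fun χ => ⟨fun _ => BranchMap.incl le_rfl, fun x y h => by
      rw [show x = y from funext fun c => h c (Finset.notMem_empty c)]⟩⟩
  | insert a s ha ih =>
    obtain ⟨M, hnM, hM⟩ := ih
    obtain ⟨N, hMN, hN⟩ := hX a M ((∀ c, (X c).obj M) → K)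
    refine ⟨N, hnM.trans hMN, fun χ => ?_⟩
    obtain ⟨g, hg⟩ := hN fun e x =>
      χ (Function.update (fun c => (X c).act (BranchMap.incl hMN) (x c)) a e)
    let h : α → BranchMap M N := Function.update (fun _ => BranchMap.incl hMN) a g
    have hupd : ∀ x : ∀ c, (X c).obj M, (fun c => (X c).act (h c) (x c)) =
        Function.update (fun c => (X c).act (BranchMap.incl hMN) (x c)) a ((X a).act g (x a)) := by
      intro x
      funext c
      by_cases hc : c = a
      · subst hc; simp [h]
      · simp [h, hc]
    obtain ⟨f, hf⟩ := hM fun x => χ fun c => (X c).act (h c) (x c)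
    refine ⟨fun c => (h c).comp (f c), fun x y hxy => ?_⟩
    simp only [act_comp]
    have h1 := hf x (Function.update y a (x a)) (fun c hc => by
      by_cases hca : c = a
      · subst hca; simp
      · rw [Function.update_of_ne hca]
        exact hxy c (by simp [hca, hc]))
    refine h1.trans ?_
    have h2 : (fun c => (X c).act (f c) (Function.update y a (x a) c)) =
        Function.update (fun c => (X c).act (f c) (y c)) a ((X a).act (f a) (x a)) := by
      funext c
      by_cases hc : c = a
      · subst hc; simp
      · simp [hc]
    have h3 : ∀ z : ∀ c, (X c).obj M, ∀ e : (X a).obj M,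
        χ (fun c => (X c).act (h c) (Function.update z a e c)) =
          χ (fun c => (X c).act (h c) (z c)) := by
      intro z e
      rw [hupd z, ← congrFun (hg e (z a)) z, hupd]
      congr 1
      funext c
      by_cases hc : c = a
      · subst hc; simp
      · simp [hc]
    exact (congrArg (fun z => χ fun c => (X c).act (h c) (z c)) h2).trans (h3 _ _)

/-- The product Ramsey theorem. -/
theorem exists_ramsey_pi [Finite α] (hX : ∀ c, (X c).IsRamsey) (K : Type u) [Finite K] (n : ℕ) :
    ∃ N, n ≤ N ∧ ∀ χ : (∀ c, (X c).obj N) → K, ∃ g : α → BranchMap n N,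
      ∀ x y : ∀ c, (X c).obj n,
        χ (fun c => (X c).act (g c) (x c)) = χ (fun c => (X c).act (g c) (y c)) := by
  cases nonempty_fintype α
  obtain ⟨N, hnN, hN⟩ := exists_ramsey_pi_finset hX K n Finset.univ
  refine ⟨N, hnN, fun χ => ?_⟩
  obtain ⟨g, hg⟩ := hN χ
  exact ⟨g, fun x y => hg x y fun c hc => absurd (Finset.mem_univ c) hc⟩

/-- A version of the product Ramsey theorem for finitely many colorings at once, each of them
depending on the coordinates in the range of an embedding. -/
theorem exists_ramsey_pi_embedding [Finite α] (hX : ∀ c, (X c).IsRamsey) {P : Type*}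
    (K : Type u) [Finite K] (n : ℕ) (J : Finset (α ↪ P)) :
    ∃ N, n ≤ N ∧ ∀ χ : (α ↪ P) → (∀ c, (X c).obj N) → K, ∃ g : P → BranchMap n N,
      ∀ j ∈ J, ∀ x y : ∀ c, (X c).obj n,
        χ j (fun c => (X c).act (g (j c)) (x c)) = χ j (fun c => (X c).act (g (j c)) (y c)) := by
  classical
  induction J using Finset.induction_on with
  | empty => exact ⟨n, le_rfl, fun χ => ⟨fun _ => BranchMap.incl le_rfl, by simp⟩⟩
  | insert j J hj ih =>
    obtain ⟨M, hnM, hM⟩ := ih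
    obtain ⟨N, hMN, hN⟩ := exists_ramsey_pi hX K M
    refine ⟨N, hnM.trans hMN, fun χ => ?_⟩
    obtain ⟨h, hh⟩ := hN (χ j)
    -- Injectivity of `j` allows the branch maps found for the elements of `α` to be placed at the
    -- positions `j c`.
    let h' : P → BranchMap M N := Function.extend j h fun _ => BranchMap.incl hMN
    obtain ⟨g, hg⟩ := hM fun i x => χ i fun c => (X c).act (h' (i c)) (x c)
    refine ⟨fun p => (h' p).comp (g p), fun i hi x y => ?_⟩
    simp only [act_comp]
    rcases Finset.mem_insert.1 hi with rfl | hi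
    · have : ∀ c, h' (i c) = h c := fun c => i.injective.extend_apply _ _ _
      simp only [this]
      exact hh _ _
    · exact hg i hi x y

theorem isRamsey_cone [LinearOrder α] [Finite α] (hX : ∀ c, (X c).IsRamsey) :
    (cone X).IsRamsey := by
  intro n K _
  obtain ⟨P, hnP, hP⟩ := OrderEmbedding.exists_ramsey α K n
  cases nonempty_fintype (α ↪ Fin P)
  obtain ⟨M, hnM, hM⟩ := exists_ramsey_pi_embedding hX K n (Finset.univ : Finset (α ↪ Fin P))
  have hMN := le_max_left M P
  have hPN := le_max_right M P
  refine ⟨max M P, hnM.trans hMN, fun χ => ?_⟩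
  -- If there are no data or no placements, the cone is empty at `n` and nothing is to be shown;
  -- otherwise `x₀` and `j₀` supply a reference point and a default color.
  rcases isEmpty_or_nonempty (∀ c, (X c).obj n) with h0 | ⟨⟨x₀⟩⟩
  · exact ⟨BranchMap.incl (hnM.trans hMN), fun x => h0.elim x.2⟩
  rcases isEmpty_or_nonempty (α ↪o Fin n) with h1 | ⟨⟨j₀⟩⟩
  · exact ⟨BranchMap.incl (hnM.trans hMN), fun x => h1.elim x.1⟩
  let ψ : (α ↪o Fin P) → (∀ c, (X c).obj M) → K := fun j x =>
    χ (j.trans (Fin.castLEOrderEmb hPN), fun c => (X c).act (BranchMap.incl hMN) (x c))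
  let k₀ : K := ψ (j₀.trans (Fin.castLEOrderEmb hnP)) fun c => (X c).act (BranchMap.incl hnM) (x₀ c)
  have hinj : Function.Injective (RelEmbedding.toEmbedding : (α ↪o Fin P) → (α ↪ Fin P)) :=
    fun a b h => RelEmbedding.ext fun c => DFunLike.congr_fun h c
  obtain ⟨g, hg⟩ := hM (Function.extend RelEmbedding.toEmbedding ψ fun _ _ => k₀)
  replace hg : ∀ (j : α ↪o Fin P) (x y : ∀ c, (X c).obj n),
      ψ j (fun c => (X c).act (g (j c)) (x c)) = ψ j (fun c => (X c).act (g (j c)) (y c)) := by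
    intro j x y
    have := hg j.toEmbedding (Finset.mem_univ _) x y
    rwa [hinj.extend_apply] at this
  -- The thinning `g` has been fixed at all `P` positions, so the color of a placement is well
  -- defined before the `n` positions are selected.
  obtain ⟨i, hi⟩ := hP fun j => ψ j fun c => (X c).act (g (j c)) (x₀ c)
  refine ⟨BranchMap.join (i.trans (Fin.castLEOrderEmb hPN))
    fun a => (BranchMap.incl hMN).comp (g (i a)), ?_⟩
  have key : ∀ x : (cone X).obj n, χ ((cone X).act (BranchMap.join
      (i.trans (Fin.castLEOrderEmb hPN)) fun a => (BranchMap.incl hMN).comp (g (i a))) x) =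
      ψ (x.1.trans i) fun c => (X c).act (g (i (x.1 c))) (x.2 c) := by
    intro x
    refine congrArg χ (Prod.ext rfl (funext fun c => ?_))
    exact (X c).act_comp _ _ _
  intro x y
  rw [key, key]
  exact (hg (x.1.trans i) x.2 x₀).trans ((hi x.1 y.1).trans (hg (y.1.trans i) y.2 x₀).symm)

end BranchSet

/-! ### Order and heights in a tree -/

namespace OrderedTree

variable {T : OrderedTree.{u}} {a b m v w x : T.Node}

theorem le_meet_iff : x ≤ T.meet v w ↔ x ≤ v ∧ x ≤ w :=
  ⟨fun h => ⟨h.trans (T.meet_spec v w).1.1, h.trans (T.meet_spec v w).1.2⟩,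
    fun h => (T.meet_spec v w).2 h⟩

theorem meet_le_left : T.meet v w ≤ v := (T.meet_spec v w).1.1

theorem meet_le_right : T.meet v w ≤ w := (T.meet_spec v w).1.2

theorem meet_eq_left_iff : T.meet v w = v ↔ v ≤ w :=
  ⟨fun h => h ▸ meet_le_right, fun h => meet_le_left.antisymm (le_meet_iff.2 ⟨le_rfl, h⟩)⟩

theorem meet_eq_right_iff : T.meet v w = w ↔ w ≤ v :=
  ⟨fun h => h ▸ meet_le_left, fun h => meet_le_right.antisymm (le_meet_iff.2 ⟨h, le_rfl⟩)⟩

theorem exists_covBy_le (h : v < w) : ∃ c, v ⋖ c ∧ c ≤ w := by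
  obtain ⟨c, hc⟩ := (Set.toFinite {x | v < x ∧ x ≤ w}).exists_minimal ⟨w, h, le_rfl⟩
  refine ⟨c, ⟨hc.prop.1, fun x hvx hxc => ?_⟩, hc.prop.2⟩
  exact hc.not_lt ⟨hvx, hxc.le.trans hc.prop.2⟩ hxc

theorem exists_le_covBy (h : v < w) : ∃ p, v ≤ p ∧ p ⋖ w := by
  obtain ⟨p, hp⟩ := (Set.toFinite {x | v ≤ x ∧ x < w}).exists_maximal ⟨v, le_rfl, h⟩
  refine ⟨p, hp.prop.1, ⟨hp.prop.2, fun x hpx hxw => ?_⟩⟩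
  exact hp.not_gt ⟨hp.prop.1.trans hpx.le, hxw⟩ hpx

theorem covBy_induction {P : T.Node → Prop} (hv : P v)
    (step : ∀ a b, v ≤ a → a ⋖ b → P a → P b) (h : v ≤ w) : P w := by
  induction w using WellFoundedLT.induction with
  | ind w ih =>
    rcases h.eq_or_lt with rfl | h
    · exact hv
    · obtain ⟨p, hvp, hpw⟩ := exists_le_covBy h
      exact step p w hvp hpw (ih p hpw.lt hvp)

theorem eq_of_covBy_of_covBy (ha : a ⋖ v) (hb : b ⋖ v) : a = b := by
  rcases T.linear_pred v a b ha.le hb.le with h | h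
  · exact h.eq_of_not_lt fun h => ha.2 h hb.lt
  · exact (h.eq_of_not_lt fun h => hb.2 h ha.lt).symm

theorem eq_of_covBy_of_le (ha : m ⋖ a) (hb : m ⋖ b) (hav : a ≤ v) (hbv : b ≤ v) : a = b := by
  rcases T.linear_pred v a b hav hbv with h | h
  · exact h.eq_of_not_lt fun h => hb.2 ha.lt h
  · exact (h.eq_of_not_lt fun h => ha.2 hb.lt h).symm

/-- A larger meet would lie above a child of `m` that equals both `a` and `b`. -/
theorem meet_eq_of_covBy (ha : m ⋖ a) (hb : m ⋖ b) (hab : a ≠ b) (hav : a ≤ v) (hbw : b ≤ w) :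
    T.meet v w = m := by
  have hm : m ≤ T.meet v w := le_meet_iff.2 ⟨ha.le.trans hav, hb.le.trans hbw⟩
  refine (hm.eq_of_not_lt fun h => hab ?_).symm
  obtain ⟨c, hmc, hc⟩ := exists_covBy_le h
  exact (eq_of_covBy_of_le ha hmc hav (hc.trans meet_le_left)).trans
    (eq_of_covBy_of_le hmc hb (hc.trans meet_le_right) hbw)

theorem htAt_strictMono : StrictMono T.htAt := fun v _ h =>
  Set.ncard_lt_ncard ⟨fun _ hx => le_trans hx h.le, fun h' => h.not_ge (h' le_rfl)⟩

theorem htAt_eq_of_covBy (h : v ⋖ w) : T.htAt w = T.htAt v + 1 := by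
  have : {x | x ≤ w} = insert w {x | x ≤ v} := by
    ext x
    simp only [Set.mem_ofPred_eq, Set.mem_insert_iff]
    refine ⟨fun hx => ?_, ?_⟩
    · rcases hx.eq_or_lt with rfl | hlt
      · exact Or.inl rfl
      · rcases T.linear_pred w x v hx h.le with h1 | h1
        · exact Or.inr h1
        · exact Or.inr (h1.eq_of_not_lt fun h2 => h.2 h2 hlt).ge
    · rintro (rfl | hx)
      · exact le_rfl
      · exact hx.trans h.le
  exact (congrArg Set.ncard this).trans (Set.ncard_insert_of_notMem h.lt.not_ge)

theorem exists_root (T : OrderedTree.{u}) : ∃ r : T.Node, ∀ v, r ≤ v := by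
  obtain ⟨r, hr⟩ := (Set.toFinite (Set.univ : Set T.Node)).exists_minimal Set.univ_nonempty
  refine ⟨r, fun v => ?_⟩
  obtain ⟨x, hxr, hxv⟩ := T.common_pred r v
  exact (hr.le_of_le trivial hxr).trans hxv

/-- The least node. -/
noncomputable def root (T : OrderedTree.{u}) : T.Node := T.exists_root.choose

theorem root_le (v : T.Node) : T.root ≤ v := T.exists_root.choose_spec v

theorem htAt_root : T.htAt T.root = 1 := by
  rw [htAt, Set.ncard_eq_one]
  exact ⟨T.root, Set.ext fun x => ⟨fun h => le_antisymm h (root_le x), fun h => le_of_eq h⟩⟩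

theorem eq_root_of_htAt_eq_one (h : T.htAt v = 1) : v = T.root := by
  refine ((root_le v).eq_of_not_lt fun hlt => ?_).symm
  have := htAt_strictMono hlt
  rw [htAt_root] at this
  omega

theorem htAt_pos (v : T.Node) : 0 < T.htAt v := by
  have := htAt_strictMono.monotone (root_le v)
  rw [htAt_root] at this
  omega

theorem htAt_le_ht (v : T.Node) : T.htAt v ≤ T.ht := T.isGreatest_ht.2 ⟨v, rfl⟩

/-- The immediate successors of a node. -/
def Child (v : T.Node) : Type u := {c : T.Node // v ⋖ c}

def Child.of (h : v ⋖ w) : Child v := ⟨w, h⟩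

instance (v : T.Node) : LinearOrder (Child v) := T.imOrder v

instance (v : T.Node) : Finite (Child v) := Subtype.finite

/-- This form avoids the meet: distinct children of `m` below `v` and `w` force `m` to be the meet.
-/
theorem lexLE_iff : T.lexLE v w ↔
    v ≤ w ∨ ∃ (m : T.Node) (a b : Child m), a < b ∧ a.1 ≤ v ∧ b.1 ≤ w := by
  constructor
  · rintro (h | ⟨-, -, a, b, hav, hbw, hab⟩)
    · exact Or.inl h
    · refine Or.inr ⟨_, a, b, lt_of_le_of_ne hab ?_, hav, hbw⟩
      intro h
      have h' : a.1 = b.1 := congrArg Subtype.val h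
      exact a.2.lt.not_ge (le_meet_iff.2 ⟨hav, h' ▸ hbw⟩)
  · rintro (h | ⟨m, a, b, hab, hav, hbw⟩)
    · exact Or.inl h
    · have hne : a.1 ≠ b.1 := fun h => hab.ne (Subtype.ext h)
      have hm := meet_eq_of_covBy a.2 b.2 hne hav hbw
      refine Or.inr ⟨fun h => hne ?_, fun h => hne ?_, ?_⟩
      · exact eq_of_covBy_of_le a.2 b.2 (hav.trans h) hbw
      · exact eq_of_covBy_of_le a.2 b.2 hav (hbw.trans h)
      · subst hm
        exact ⟨a, b, hav, hbw, hab.le⟩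

end OrderedTree

/-! ### Height preserving embeddings described locally -/

namespace HeightEmb

open OrderedTree

variable {S T : OrderedTree.{u}}

/-- A map of trees that preserves the root, immediate successors, and their order is a height
preserving embedding. -/
def ofCovBy (f : S.Node → T.Node) (hroot : f S.root = T.root) (hf : ∀ v c, v ⋖ c → f v ⋖ f c)
    (hlt : ∀ (v : S.Node) (a b : Child v), a < b →
      Child.of (hf _ _ a.2) < Child.of (hf _ _ b.2)) : HeightEmb S T :=
  have hle : ∀ v w, v ≤ w → f v ≤ f w := fun v w h =>
    covBy_induction (P := fun w => f v ≤ f w) le_rfl (fun _ _ _ hab h => h.trans (hf _ _ hab).le) h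
  have hht : ∀ v, S.htAt v = T.htAt (f v) := fun v => by
    refine covBy_induction (P := fun v => S.htAt v = T.htAt (f v)) ?_ ?_ (root_le v)
    · rw [hroot, htAt_root, htAt_root]
    · intro a b _ hab h
      rw [htAt_eq_of_covBy hab, htAt_eq_of_covBy (hf _ _ hab), h]
  have hne : ∀ (v : S.Node) (a b : Child v), a.1 ≠ b.1 → f a.1 ≠ f b.1 := fun v a b h h' => by
    rcases lt_or_gt_of_ne (fun e => h (congrArg Subtype.val e) : a ≠ b) with hab | hab
    · exact (hlt v a b hab).ne (Subtype.ext h')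
    · exact (hlt v b a hab).ne (Subtype.ext h'.symm)
  have hmeet : ∀ v w, f (S.meet v w) = T.meet (f v) (f w) := fun v w => by
    rcases (meet_le_left : S.meet v w ≤ v).eq_or_lt with h | h
    · rw [h, meet_eq_left_iff.2 (hle _ _ (meet_eq_left_iff.1 h))]
    rcases (meet_le_right : S.meet v w ≤ w).eq_or_lt with h' | h'
    · rw [h', meet_eq_right_iff.2 (hle _ _ (meet_eq_right_iff.1 h'))]
    obtain ⟨a, hma, hav⟩ := exists_covBy_le h
    obtain ⟨b, hmb, hbw⟩ := exists_covBy_le h'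
    have hab : a ≠ b := by
      rintro rfl
      exact hma.lt.not_ge (le_meet_iff.2 ⟨hav, hbw⟩)
    exact (meet_eq_of_covBy (hf _ _ hma) (hf _ _ hmb) (hne _ ⟨a, hma⟩ ⟨b, hmb⟩ hab)
      (hle _ _ hav) (hle _ _ hbw)).symm
  { toFun := f
    injective := fun v w h => by
      have h1 : T.meet (f v) (f w) = f v := meet_eq_left_iff.2 h.le
      have h2 : T.meet (f v) (f w) = f w := meet_eq_right_iff.2 h.ge
      rw [← hmeet] at h1 h2
      -- Comparable nodes with the same image have the same height and hence coincide.
      have h3 : ∀ x, f (S.meet v w) = f x → S.meet v w ≤ x → S.meet v w = x := fun x hx hle =>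
        hle.eq_of_not_lt fun hlt => by
          have := htAt_strictMono hlt
          rw [hht, hht x, hx] at this
          exact lt_irrefl _ this
      exact (h3 v h1 meet_le_left).symm.trans (h3 w h2 meet_le_right)
    map_lexLE := fun v w h => by
      rw [lexLE_iff] at h ⊢
      rcases h with h | ⟨m, a, b, hab, hav, hbw⟩
      · exact Or.inl (hle _ _ h)
      · exact Or.inr ⟨f m, Child.of (hf _ _ a.2), Child.of (hf _ _ b.2), hlt m a b hab,
          hle _ _ hav, hle _ _ hbw⟩
    map_meet := hmeet
    map_htAt := hht }

variable (f : HeightEmb S T)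

theorem map_root : f.toFun S.root = T.root :=
  eq_root_of_htAt_eq_one (by rw [← f.map_htAt, htAt_root])

/-- The heights of the two images differ by one, so no node fits between them. -/
theorem map_covBy {v c : S.Node} (h : v ⋖ c) : f.toFun v ⋖ f.toFun c := by
  have hle : f.toFun v ≤ f.toFun c := by
    rw [← meet_eq_left_iff, ← f.map_meet, meet_eq_left_iff.2 h.le]
  refine ⟨hle.lt_of_ne (f.injective.ne h.lt.ne), fun x h1 h2 => ?_⟩
  have h1 := htAt_strictMono h1
  have h2 := htAt_strictMono h2
  rw [← f.map_htAt] at h1 h2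
  rw [htAt_eq_of_covBy h] at h2
  omega

theorem map_child_lt {v : S.Node} {a b : Child v} (h : a < b) :
    Child.of (f.map_covBy a.2) < Child.of (f.map_covBy b.2) := by
  have hne : a.1 ≠ b.1 := fun e => h.ne (Subtype.ext e)
  have hne' := f.injective.ne hne
  have hl := f.map_lexLE a.1 b.1 (lexLE_iff.2 (Or.inr ⟨v, a, b, h, le_rfl, le_rfl⟩))
  rcases lexLE_iff.1 hl with hl | ⟨m, x, y, hxy, hx, hy⟩
  · exact absurd (eq_of_covBy_of_le (f.map_covBy a.2) (f.map_covBy b.2) hl le_rfl) hne'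
  · have hxy' : x.1 ≠ y.1 := fun e => hxy.ne (Subtype.ext e)
    have hm : m = f.toFun v := (meet_eq_of_covBy x.2 y.2 hxy' hx hy).symm.trans
      (meet_eq_of_covBy (f.map_covBy a.2) (f.map_covBy b.2) hne' le_rfl le_rfl)
    subst hm
    have h1 : x = Child.of (f.map_covBy a.2) :=
      Subtype.ext (eq_of_covBy_of_le x.2 (f.map_covBy a.2) hx le_rfl)
    have h2 : y = Child.of (f.map_covBy b.2) :=
      Subtype.ext (eq_of_covBy_of_le y.2 (f.map_covBy b.2) hy le_rfl)
    rwa [← h1, ← h2]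

end HeightEmb

/-! ### Uniform trees -/

/-- The nodes of the uniform tree: lists of length at most `h`, ordered by the prefix relation. -/
@[ext]
structure UniformNode (h n : ℕ) : Type u where
  list : ULift.{u} (List (Fin n))
  length_le : list.down.length ≤ h

namespace UniformNode

variable {h n : ℕ}

instance : PartialOrder (UniformNode.{u} h n) where
  le v w := v.list.down <+: w.list.down
  le_refl _ := List.prefix_rfl
  le_trans _ _ _ := List.IsPrefix.trans
  le_antisymm _ _ h h' := UniformNode.ext (ULift.ext _ _ (h.eq_of_length_le h'.length_le))

theorem lt_length {v w : UniformNode.{u} h n} (hvw : v < w) :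
    v.list.down.length < w.list.down.length :=
  hvw.le.length_le.lt_of_ne fun he =>
    hvw.ne (UniformNode.ext (ULift.ext _ _ (hvw.le.eq_of_length he)))

instance : Finite (UniformNode.{u} h n) := by
  have : Finite {l : List (Fin n) // l.length ≤ h} := List.finite_length_le (Fin n) h
  refine Finite.of_injective
    (fun v : UniformNode.{u} h n =>
      (⟨v.list.down, v.length_le⟩ : {l : List (Fin n) // l.length ≤ h}))
    fun v w hvw => UniformNode.ext (ULift.ext _ _ (congrArg Subtype.val hvw))

instance : Nonempty (UniformNode.{u} h n) := ⟨⟨⟨[]⟩, Nat.zero_le h⟩⟩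

theorem covBy_iff {v c : UniformNode.{u} h n} :
    v ⋖ c ↔ ∃ a, c.list.down = v.list.down ++ [a] := by
  constructor
  · intro hvc
    obtain ⟨t, ht⟩ := hvc.le
    cases t with
    | nil => exact absurd (UniformNode.ext (ULift.ext _ _ (by simpa using ht))) hvc.lt.ne
    | cons a t =>
      refine ⟨a, ?_⟩
      have hx : v.list.down ++ [a] <+: c.list.down := ⟨t, by simpa using ht⟩
      let x : UniformNode.{u} h n := ⟨⟨v.list.down ++ [a]⟩, hx.length_le.trans c.length_le⟩
      have hvx : v < x := lt_of_le_of_ne (List.prefix_append _ _) fun e => by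
        have := congrArg (fun z => z.list.down.length) e
        simp [x] at this
      have hxc : x ≤ c := hx
      rw [← hxc.eq_of_not_lt (hvc.2 hvx)]
  · rintro ⟨a, ha⟩
    have hle : v ≤ c := ⟨[a], ha.symm⟩
    have hlen : c.list.down.length = v.list.down.length + 1 := by simp [ha]
    refine ⟨hle.lt_of_ne fun e => ?_, fun x h1 h2 => ?_⟩
    · rw [e] at hlen
      omega
    · have := lt_length h1
      have := lt_length h2
      omega

/-- The last entry of the list. -/
def label (v : UniformNode.{u} h n) : ℕ := (v.list.down.map Fin.val).getLastD 0

theorem label_eq {v : UniformNode.{u} h n} {l : List (Fin n)} {a : Fin n}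
    (hv : v.list.down = l ++ [a]) : v.label = a := by
  simp [label, hv]

end UniformNode

namespace OrderedTree

open UniformNode

/-- The tree of height `h + 1` in which every node below the top level has `n` immediate
successors. -/
noncomputable def uniform (h n : ℕ) : OrderedTree.{u} where
  Node := UniformNode.{u} h n
  common_pred v w := ⟨⟨⟨[]⟩, Nat.zero_le h⟩, List.nil_prefix, List.nil_prefix⟩
  linear_pred v x y hx hy := List.prefix_or_prefix_of_prefix hx hy
  -- Children of `v` differ only in their last entry. The default value of `label` occurs only at
  -- the empty list, which is no child.
  imOrder v := LinearOrder.lift' (fun c => c.1.label) fun c d hcd => by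
    obtain ⟨a, ha⟩ := covBy_iff.1 c.2
    obtain ⟨b, hb⟩ := covBy_iff.1 d.2
    have : a = b := Fin.ext ((label_eq ha).symm.trans (hcd.trans (label_eq hb)))
    refine Subtype.ext (UniformNode.ext (ULift.ext _ _ ?_))
    rw [ha, hb, this]

variable {h n N : ℕ}

/-- The list of labels on the path to a node. -/
def toList (v : (uniform.{u} h n).Node) : List (Fin n) := UniformNode.list v |>.down

/-- The node with a given list of labels. -/
def ofList (l : List (Fin n)) (hl : l.length ≤ h) : (uniform.{u} h n).Node :=
  (⟨⟨l⟩, hl⟩ : UniformNode.{u} h n)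

theorem length_toList_le (v : (uniform.{u} h n).Node) : (toList v).length ≤ h :=
  UniformNode.length_le v

theorem toList_injective : Function.Injective (toList : (uniform.{u} h n).Node → List (Fin n)) :=
  fun _ _ e => UniformNode.ext (ULift.ext _ _ e)

theorem uniform_covBy_iff {v c : (uniform.{u} h n).Node} :
    v ⋖ c ↔ ∃ a, toList c = toList v ++ [a] := covBy_iff

theorem uniform_child_lt_iff {v : (uniform.{u} h n).Node} {c d : Child v} {a b : Fin n}
    (hc : toList c.1 = toList v ++ [a]) (hd : toList d.1 = toList v ++ [b]) :
    c < d ↔ a < b := by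
  have : c < d ↔ UniformNode.label c.1 < UniformNode.label d.1 := Iff.rfl
  rw [this, label_eq hc, label_eq hd, Fin.lt_def]

theorem toList_root : toList (uniform.{u} h n).root = [] := by
  have : (uniform.{u} h n).root ≤ ofList [] (Nat.zero_le h) := root_le _
  exact List.prefix_nil.1 this

theorem uniform_htAt (v : (uniform.{u} h n).Node) :
    (uniform.{u} h n).htAt v = (toList v).length + 1 := by
  refine covBy_induction (P := fun v => (uniform.{u} h n).htAt v = (toList v).length + 1) ?_ ?_
    (root_le v)
  · rw [htAt_root, toList_root, List.length_nil]
  · intro a b _ hab ih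
    obtain ⟨c, hc⟩ := uniform_covBy_iff.1 hab
    rw [htAt_eq_of_covBy hab, hc, List.length_append, ih, List.length_singleton]

theorem uniform_htAt_le (v : (uniform.{u} h n).Node) : (uniform.{u} h n).htAt v ≤ h + 1 := by
  rw [uniform_htAt]
  exact Nat.succ_le_succ (length_toList_le v)

theorem uniform_ht (hn : 0 < n) : (uniform.{u} h n).ht = h + 1 := by
  obtain ⟨v, hv⟩ := (uniform.{u} h n).isGreatest_ht.1
  refine le_antisymm (hv ▸ uniform_htAt_le v) ?_
  let x : (uniform.{u} h n).Node := ofList (List.replicate h ⟨0, hn⟩) (by simp)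
  have hx : (toList x).length = h := List.length_replicate
  have := htAt_le_ht x
  rwa [uniform_htAt, hx] at this

section Path

variable {T : OrderedTree.{u}}

/-- The list of labels on the path to a node, for given labels of the immediate successors. -/
noncomputable def path (j : ∀ v : T.Node, Child v ↪o Fin n) (v : T.Node) : List (Fin n) :=
  open Classical in
  if hp : ∃ p, p ⋖ v then path j hp.choose ++ [j hp.choose ⟨v, hp.choose_spec⟩] else []
termination_by (wellFounded_lt (α := T.Node)).wrap v
decreasing_by exact hp.choose_spec.lt

/-- The parent is unique, so the one chosen in `path` is `v`. -/
theorem path_covBy (j : ∀ v : T.Node, Child v ↪o Fin n) {v : T.Node} (c : Child v) :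
    path j c.1 = path j v ++ [j v c] := by
  have hp : ∃ p, p ⋖ c.1 := ⟨v, c.2⟩
  have key : ∀ p (hpc : p ⋖ c.1), path j p ++ [j p ⟨c.1, hpc⟩] = path j v ++ [j v c] := by
    intro p hpc
    obtain rfl := eq_of_covBy_of_covBy hpc c.2
    rfl
  rw [path, dif_pos hp]
  exact key _ _

theorem path_root (j : ∀ v : T.Node, Child v ↪o Fin n) : path j T.root = [] := by
  rw [path, dif_neg]
  rintro ⟨p, hp⟩
  exact hp.lt.not_ge (root_le p)

theorem length_path (j : ∀ v : T.Node, Child v ↪o Fin n) (v : T.Node) :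
    (path j v).length + 1 = T.htAt v := by
  refine covBy_induction (P := fun v => (path j v).length + 1 = T.htAt v) ?_ ?_ (root_le v)
  · rw [path_root, htAt_root, List.length_nil]
  · intro a b _ hab ih
    rw [path_covBy j ⟨b, hab⟩, htAt_eq_of_covBy hab, ← ih, List.length_append,
      List.length_singleton]

/-- With as many branches as `T` has nodes, the children of every node can be placed. -/
theorem exists_heightEmb_uniform (hT : T.ht ≤ h + 1) :
    ∃ n, 0 < n ∧ Nonempty (HeightEmb T (uniform.{u} h n)) := by
  refine ⟨Nat.card T.Node, Nat.card_pos, ?_⟩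
  have hj : ∀ v : T.Node, Nonempty (Child v ↪o Fin (Nat.card T.Node)) := fun v => by
    cases nonempty_fintype (Child v)
    have hcard : Fintype.card (Child v) ≤ Nat.card T.Node := by
      rw [← Nat.card_eq_fintype_card]
      exact Nat.card_le_card_of_injective (fun c : Child v => c.1) fun _ _ e => Subtype.ext e
    exact ⟨(Fintype.orderIsoFinOfCardEq (Child v) rfl).symm.toOrderEmbedding.trans
      (Fin.castLEOrderEmb hcard)⟩
  let j := fun v => (hj v).some
  let f : T.Node → (uniform.{u} h (Nat.card T.Node)).Node := fun v =>
    ofList (path j v) (by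
      have h1 := length_path j v
      have h2 := (htAt_le_ht v).trans hT
      omega)
  have hf : ∀ v (c : Child v), toList (f c.1) = toList (f v) ++ [j v c] := fun v c => path_covBy j c
  refine ⟨HeightEmb.ofCovBy f (toList_injective ?_)
    (fun v c hvc => uniform_covBy_iff.2 ⟨_, hf v ⟨c, hvc⟩⟩) fun v a b hab => ?_⟩
  · rw [toList_root]
    exact path_root j
  · exact (uniform_child_lt_iff (hf v a) (hf v b)).2 ((j v).strictMono hab)

end Path

/-! ### Embeddings into uniform trees as labelings -/

/-- The labelings by numbers of the nodes at most `h` levels above a node `v`, excluding `v`, that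
are increasing on the immediate successors of each node. -/
noncomputable def labelings (S : OrderedTree.{u}) : ℕ → S.Node → BranchSet.{u}
  | 0, _ => BranchSet.point
  | h + 1, v => BranchSet.cone fun c : Child v => labelings S h c.1

theorem isRamsey_labelings (S : OrderedTree.{u}) (h : ℕ) (v : S.Node) :
    (S.labelings h v).IsRamsey := by
  induction h generalizing v with
  | zero => exact BranchSet.isRamsey_point
  | succ h ih => exact BranchSet.isRamsey_cone fun c => ih c.1

end OrderedTree

namespace BranchMap

open OrderedTree

variable {n N : ℕ}

theorem map_concat (g : BranchMap n N) (l : List (Fin n)) (a : Fin n) :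
    g.map (l ++ [a]) = g.map l ++ [g l a] := by
  induction l generalizing g with
  | nil => rfl
  | cons b l ih => exact congrArg (g [] b :: ·) (ih (g.sub b))

theorem length_map (g : BranchMap n N) (l : List (Fin n)) : (g.map l).length = l.length := by
  induction l generalizing g with
  | nil => rfl
  | cons b l ih => exact congrArg (· + 1) (ih (g.sub b))

/-- The map of uniform trees induced by a branch map. -/
def mapNode (g : BranchMap n N) (h : ℕ) (v : (uniform.{u} h n).Node) : (uniform.{u} h N).Node :=
  ofList (g.map (toList v)) ((g.length_map _).trans_le (length_toList_le v))

theorem toList_mapNode (g : BranchMap n N) (h : ℕ) (v : (uniform.{u} h n).Node) :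
    toList (g.mapNode h v) = g.map (toList v) := rfl

theorem toList_mapNode_of_eq (g : BranchMap n N) (h : ℕ) {v c : (uniform.{u} h n).Node}
    {a : Fin n} (hc : toList c = toList v ++ [a]) :
    toList (g.mapNode h c) = toList (g.mapNode h v) ++ [g (toList v) a] := by
  rw [toList_mapNode, toList_mapNode, hc, map_concat]

/-- The embedding of uniform trees induced by a branch map. -/
noncomputable def toHeightEmb (g : BranchMap n N) (h : ℕ) :
    HeightEmb (uniform.{u} h n) (uniform.{u} h N) :=
  HeightEmb.ofCovBy (g.mapNode h)
    (toList_injective (by rw [toList_mapNode, toList_root, toList_root]; rfl))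
    (fun v c hvc => by
      obtain ⟨a, ha⟩ := uniform_covBy_iff.1 hvc
      exact uniform_covBy_iff.2 ⟨_, g.toList_mapNode_of_eq h ha⟩)
    (fun v a b hab => by
      obtain ⟨x, hx⟩ := uniform_covBy_iff.1 a.2
      obtain ⟨y, hy⟩ := uniform_covBy_iff.1 b.2
      exact (uniform_child_lt_iff (g.toList_mapNode_of_eq h hx) (g.toList_mapNode_of_eq h hy)).2
        ((g _).strictMono ((uniform_child_lt_iff hx hy).1 hab)))

end BranchMap

namespace HeightEmb

open OrderedTree

variable {S : OrderedTree.{u}} {h n N : ℕ}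

theorem exists_label (f : HeightEmb S (uniform.{u} h n)) (v : S.Node) (c : Child v) :
    ∃ a, toList (f.toFun c.1) = toList (f.toFun v) ++ [a] :=
  uniform_covBy_iff.1 (f.map_covBy c.2)

/-- The labels of the images of the immediate successors of a node. -/
noncomputable def label (f : HeightEmb S (uniform.{u} h n)) (v : S.Node) : Child v ↪o Fin n :=
  OrderEmbedding.ofStrictMono (fun c => (f.exists_label v c).choose) fun c d hcd =>
    (uniform_child_lt_iff (f.exists_label v c).choose_spec (f.exists_label v d).choose_spec).1
      (f.map_child_lt hcd)

theorem toList_child (f : HeightEmb S (uniform.{u} h n)) (v : S.Node) (c : Child v) :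
    toList (f.toFun c.1) = toList (f.toFun v) ++ [f.label v c] := (f.exists_label v c).choose_spec

/-- The labels of the images of the nodes at most `k` levels above a node. -/
noncomputable def labeling (f : HeightEmb S (uniform.{u} h n)) :
    ∀ (k : ℕ) (v : S.Node), (S.labelings k v).obj n
  | 0, _ => PUnit.unit
  | k + 1, v => (f.label v, fun c => labeling f k c.1)

theorem label_comp (f : HeightEmb S (uniform.{u} h n)) (g : BranchMap n N) (v : S.Node) :
    ((g.toHeightEmb h).comp f).label v = (f.label v).trans (g (toList (f.toFun v))) := by
  refine RelEmbedding.ext fun c => ?_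
  have h1 := ((g.toHeightEmb h).comp f).toList_child v c
  have h2 : ∀ w, toList (((g.toHeightEmb h).comp f).toFun w) = g.map (toList (f.toFun w)) :=
    fun _ => rfl
  rw [h2, h2, f.toList_child, BranchMap.map_concat] at h1
  exact (List.singleton_inj.1 (List.append_cancel_left h1)).symm

/-- Above `v`, the branch map acts through its restriction to the subtree at the image of `v`; the
induction passes to a child by appending its label. -/
theorem labeling_comp (f : HeightEmb S (uniform.{u} h n)) (g : BranchMap n N) (k : ℕ)
    (v : S.Node) : ((g.toHeightEmb h).comp f).labeling k v =
      (S.labelings k v).act (fun l => g (toList (f.toFun v) ++ l)) (f.labeling k v) := by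
  induction k generalizing v with
  | zero => rfl
  | succ k ih =>
    refine Prod.ext ?_ (funext fun c => ?_)
    · refine (f.label_comp g v).trans ?_
      change _ = (f.label v).trans (g (toList (f.toFun v) ++ []))
      rw [List.append_nil]
    · refine (ih c.1).trans ?_
      change _ = (S.labelings k c.1).act (fun l => g (toList (f.toFun v) ++ f.label v c :: l))
        (f.labeling k c.1)
      simp only [f.toList_child, List.append_assoc, List.singleton_append]

/-- Labels determine the images along the path from `v` to `w`. The bound `hk` ensures that `k`
levels suffice, since an embedding into `uniform h n` leaves no node of `S` above height `h + 1`. -/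
theorem eq_of_labeling_eq {f f' : HeightEmb S (uniform.{u} h n)} (k : ℕ) (v : S.Node)
    (hk : h + 1 ≤ S.htAt v + k) (hv : f.toFun v = f'.toFun v)
    (hl : f.labeling k v = f'.labeling k v) {w : S.Node} (hw : v ≤ w) :
    f.toFun w = f'.toFun w := by
  induction k generalizing v with
  | zero =>
    rcases hw.eq_or_lt with rfl | hlt
    · exact hv
    · have h1 := htAt_strictMono hlt
      have h2 := uniform_htAt_le (f.toFun w)
      rw [← f.map_htAt] at h2
      omega
  | succ k ih =>
    rcases hw.eq_or_lt with rfl | hlt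
    · exact hv
    · obtain ⟨c, hvc, hcw⟩ := exists_covBy_le hlt
      refine ih c (by rw [htAt_eq_of_covBy hvc]; omega) (toList_injective ?_) ?_ hcw
      · have h1 : f.label v = f'.label v := congrArg Prod.fst hl
        rw [f.toList_child v ⟨c, hvc⟩, f'.toList_child v ⟨c, hvc⟩, hv, h1]
      · exact congrFun (congrArg Prod.snd hl) ⟨c, hvc⟩

theorem labeling_injective :
    Function.Injective fun f : HeightEmb S (uniform.{u} h n) => f.labeling h S.root := by
  intro f f' hl
  refine HeightEmb.ext (funext fun w => ?_)
  refine eq_of_labeling_eq h S.root (by rw [htAt_root, add_comm]) ?_ hl (root_le w)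
  rw [map_root, map_root]

end HeightEmb

/-! ### The theorem -/

open OrderedTree in
theorem theorem4p4 (r : ℕ) (S T : OrderedTree.{u}) :
    ∃ V : OrderedTree.{u}, V.ht = T.ht ∧
      ∀ (C : Type w) (χ : HeightEmb S V → C), (Set.range χ).encard ≤ r →
        ∃ g : HeightEmb T V, ∀ f₁ f₂ : HeightEmb S T, χ (g.comp f₁) = χ (g.comp f₂) := by
  obtain ⟨h, hh⟩ : ∃ h, T.ht = h + 1 :=
    Nat.exists_eq_succ_of_ne_zero ((htAt_pos T.root).trans_le (htAt_le_ht _)).ne'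
  obtain ⟨n, hn, ⟨t⟩⟩ := exists_heightEmb_uniform hh.le
  -- One color more than `r` keeps the color set nonempty when `r = 0`, as a default for labelings
  -- that come from no embedding.
  obtain ⟨N, hnN, hN⟩ := S.isRamsey_labelings h S.root n (ULift.{u} (Fin (r + 1)))
  refine ⟨uniform h N, (uniform_ht (hn.trans_le hnN)).trans hh.symm, fun C χ hχ => ?_⟩
  have hfin : (Set.range χ).Finite := Set.finite_of_encard_le_coe hχ
  have := hfin.to_subtype
  have hcard : Nat.card (Set.range χ) ≤ r := by
    rwa [← hfin.cast_ncard_eq, Nat.cast_le] at hχ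
  let e : Set.range χ → ULift.{u} (Fin (r + 1)) := fun c =>
    ⟨Fin.castLE (by omega) (Finite.equivFin _ c)⟩
  have he : Function.Injective e := fun a b hab =>
    (Finite.equivFin _).injective (Fin.castLE_injective (by omega) (ULift.up_injective hab))
  obtain ⟨g, hg⟩ := hN (Function.extend (fun f => f.labeling h S.root)
    (fun f => e ⟨χ f, f, rfl⟩) fun _ => ⟨0⟩)
  have key : ∀ f : HeightEmb S T, (((g.toHeightEmb h).comp t).comp f).labeling h S.root =
      (S.labelings h S.root).act g ((t.comp f).labeling h S.root) := fun f => by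
    have := (t.comp f).labeling_comp g h S.root
    rw [HeightEmb.map_root, toList_root] at this
    exact this
  -- `T` is placed in `uniform h n` by `t`, and all of `uniform h n` is sent to the homogeneous copy
  -- given by `g`.
  refine ⟨(g.toHeightEmb h).comp t, fun f₁ f₂ => ?_⟩
  have := hg ((t.comp f₁).labeling h S.root) ((t.comp f₂).labeling h S.root)
  rw [← key, ← key, HeightEmb.labeling_injective.extend_apply,
    HeightEmb.labeling_injective.extend_apply] at this
  exact congrArg Subtype.val (he this)
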